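/- Let $\beta>0$. A single spin is a càdlàg function $\sigma:[0,\beta]\to\{-1,+1\}$; let $\Sigma$ be the set of single spins, with the $\sigma$-algebra generated by the maps $\sigma\mapsto\sigma(t)$, $t\in[0,\beta]$, and let $+,-\in\Sigma$ be the two constant configurations. For $\lambda\ge 0$ let $\varphi_\lambda$ be the law on $\Sigma$ of the spin that flips exactly at the points of a Poisson point process of intensity $\lambda$ on $[0,\beta]$ and is, with equal probability, one of the two configurations with these flips. For $h\in L^1([0,\beta])$ put $h\bullet\sigma=\int_0^\beta h(t)\sigma(t)\,dt$ and define the probability measures (free and periodic imaginary-time boundary conditions) $$\mu^{\emptyset}_{h,\lambda}(d\sigma)=\frac{1}{Z}\,e^{h\bullet\sigma}\,\varphi_\lambda(d\sigma),\qquad \mu^{\mathrm{per}}_{h,\lambda}(d\sigma)=\frac{1}{Z^{\mathrm{per}}}\,\mathbf 1_{\{\sigma(0)=\sigma(\beta)\}}\,e^{h\bullet\sigma}\,\varphi_\lambda(d\sigma).$$ A measurable function $f:\Sigma\to\mathbb R$ is called increasing if $f(\sigma)\le f(\sigma')$ whenever $\sigma(t)\le\sigma'(t)$ for almost every $t\in[0,\beta]$.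 For probability measures $\nu,\nu'$ on $\Sigma$ write $\nu\prec\nu'$ if $\nu(f)\le\nu'(f)$ for every increasing $f$. **Theorem 3.2.** Let $0<\beta<\infty$ and $M<\infty$. There exists $c>0$, depending only on $\beta$ and $M$, such that for all $h,h'\in L^1([0,\beta])$ and $\lambda\ge 0$ with $\|h\|_1<M$, $\|h'\|_1<M$, $\lambda<M$ and $h'\ge h$ almost everywhere, and for each $\pi\in\{\emptyset,\mathrm{per}\}$, $$\mu^{\pi}_{h,\lambda}\prec\mu^{\pi}_{h',\lambda},$$ and moreover, for every increasing $f$, $$\mu^{\pi}_{h',\lambda}(f)-\mu^{\pi}_{h,\lambda}(f)\;\ge\; c\,\bigl(f(+)-f(-)\bigr)\int_0^\beta\bigl(h'(t)-h(t)\bigr)\,dt .$$ -/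

import Mathlib

open MeasureTheory Set Filter Topology
open scoped ENNReal Nat

noncomputable section

/-- Lebesgue measure on the interval `[0, β]`, seen as a type. -/
def lebesgue (β : ℝ) : Measure (Icc (0 : ℝ) β) := Measure.comap Subtype.val volume

theorem lebesgue_univ (β : ℝ) : lebesgue β univ = ENNReal.ofReal β := by
  rw [lebesgue, comap_subtype_coe_apply measurableSet_Icc, image_univ, Subtype.range_coe]
  simp

instance (β : ℝ) : IsFiniteMeasure (lebesgue β) := ⟨by simp [lebesgue_univ]⟩

/-- A single spin on the imaginary-time interval `[0, β]`: a cadlag function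
`[0, β] → {-1, 1}` (with `{-1, 1}` viewed inside `ℝ`). -/
@[ext] structure SpinPath (β : ℝ) where
  toFun : Icc (0 : ℝ) β → ℝ
  spin : ∀ t, toFun t = 1 ∨ toFun t = -1
  right_cont : ∀ t, ContinuousWithinAt toFun (Ici t) t
  left_lim : ∀ t, ∃ l, Tendsto toFun (𝓝[<] t) (𝓝 l)

namespace SpinPath

variable {β : ℝ}

instance : CoeFun (SpinPath β) (fun _ => Icc (0 : ℝ) β → ℝ) := ⟨SpinPath.toFun⟩

/-- The σ-algebra generated by the coordinates `σ ↦ σ t`, equivalently by the events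
`{σ t = 1}`. -/
instance : MeasurableSpace (SpinPath β) :=
  MeasurableSpace.comap SpinPath.toFun MeasurableSpace.pi

/-- The configuration identically equal to `+1`. -/
def plus (β : ℝ) : SpinPath β where
  toFun _ := 1
  spin _ := Or.inl rfl
  right_cont _ := continuousWithinAt_const
  left_lim _ := ⟨1, tendsto_const_nhds⟩

/-- The configuration identically equal to `-1`. -/
def minus (β : ℝ) : SpinPath β where
  toFun _ := -1
  spin _ := Or.inr rfl
  right_cont _ := continuousWithinAt_const
  left_lim _ := ⟨-1, tendsto_const_nhds⟩

theorem eventually_count_right {n : ℕ} (x : Fin n → Icc (0 : ℝ) β) (t : Icc (0 : ℝ) β) :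
    ∀ᶠ s in 𝓝[≥] t, ∀ i, (x i ≤ s ↔ x i ≤ t) := by
  rw [eventually_all]
  intro i
  by_cases hi : x i ≤ t
  · filter_upwards [self_mem_nhdsWithin] with s hs
    exact ⟨fun _ => hi, fun _ => hi.trans hs⟩
  · filter_upwards [mem_nhdsWithin_of_mem_nhds (Iio_mem_nhds (not_le.1 hi))] with s hs
    exact ⟨fun h => absurd h (not_le.2 hs), fun h => absurd h hi⟩

theorem eventually_count_left {n : ℕ} (x : Fin n → Icc (0 : ℝ) β) (t : Icc (0 : ℝ) β) :
    ∀ᶠ s in 𝓝[<] t, ∀ i, (x i ≤ s ↔ x i < t) := by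
  rw [eventually_all]
  intro i
  by_cases hi : x i < t
  · filter_upwards [mem_nhdsWithin_of_mem_nhds (Ioi_mem_nhds hi)] with s hs
    exact ⟨fun _ => hi, fun _ => le_of_lt hs⟩
  · filter_upwards [self_mem_nhdsWithin] with s hs
    exact ⟨fun h => absurd (lt_of_le_of_lt h hs) hi, fun h => absurd h hi⟩

/-- The configuration that starts from the spin `ε` and flips at the points `x i`:
`σ t = ε * (-1) ^ #{i | x i ≤ t}`. -/
def flipPath (ε : ℤˣ) {n : ℕ} (x : Fin n → Icc (0 : ℝ) β) : SpinPath β where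
  toFun t := ((ε : ℤ) : ℝ) * (-1) ^ (Finset.univ.filter fun i => x i ≤ t).card
  spin t := by
    rcases Int.units_eq_one_or ε with rfl | rfl <;>
      rcases neg_one_pow_eq_or ℝ (Finset.univ.filter fun i => x i ≤ t).card with h | h <;>
      simp [h]
  right_cont t := by
    refine tendsto_const_nhds.congr' ?_
    filter_upwards [eventually_count_right x t] with s hs
    simp only [hs]
  left_lim t := by
    refine ⟨((ε : ℤ) : ℝ) * (-1) ^ (Finset.univ.filter fun i => x i < t).card,
      tendsto_const_nhds.congr' ?_⟩
    filter_upwards [eventually_count_left x t] with s hs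
    simp only [hs]

/-- `flipPath` is measurable, so that the push-forwards below are the intended ones. -/
theorem measurable_flipPath (ε : ℤˣ) (n : ℕ) :
    Measurable (flipPath ε : (Fin n → Icc (0 : ℝ) β) → SpinPath β) := by
  refine measurable_comap_iff.2 (measurable_pi_iff.2 fun t => ?_)
  have hcard : ∀ x : Fin n → Icc (0 : ℝ) β,
      (Finset.univ.filter fun i => x i ≤ t).card = ∑ i, if x i ≤ t then 1 else 0 := by
    intro x; simp
  simp only [Function.comp_def, flipPath, hcard]
  have hm : Measurable fun x : Fin n → Icc (0 : ℝ) β => ∑ i, if x i ≤ t then 1 else 0 :=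
    Finset.measurable_sum _ fun i _ =>
      Measurable.ite (measurableSet_le (measurable_pi_apply i) measurable_const)
        measurable_const measurable_const
  exact (measurable_from_nat (f := fun k : ℕ => ((ε : ℤ) : ℝ) * (-1) ^ k)).comp hm

/-- The law `φ` of a free spin: the flips are the points of a Poisson point process of intensity
`lam` on `[0, β]`, and the initial value is `±1` with probability `1/2` each, independently of
the flips.

The Poisson process has `n` points with probability `exp (-lam β) (lam β) ^ n / n!`, and given
their number the points are independent and uniform, i.e. have law `β ^ (-n) dx`; the powers of
`β` cancel. -/
def freeLaw (β lam : ℝ) : Measure (SpinPath β) :=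
  Measure.sum fun n : ℕ =>
    ENNReal.ofReal (Real.exp (-(lam * β)) * lam ^ n / n !) •
      ∑ ε : ℤˣ, (2⁻¹ : ℝ≥0∞) •
        (Measure.pi fun _ : Fin n => lebesgue β).map (flipPath ε)

/-- The pairing `h • σ = ∫₀^β h(t) σ(t) dt` (for the Lebesgue measure on `[0, β]`). -/
def dot (h : Icc (0 : ℝ) β → ℝ) (σ : SpinPath β) : ℝ := ∫ t, h t * σ t ∂lebesgue β

/-- Boundary conditions in imaginary time. -/
inductive TimeBC
  | free
  | periodic

/-- The configurations allowed by a boundary condition: all of them, or those with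
`σ(0) = σ(β)`. -/
def TimeBC.allowed (hβ : 0 < β) : TimeBC → Set (SpinPath β)
  | .free => univ
  | .periodic => {σ | σ ⟨0, left_mem_Icc.2 hβ.le⟩ = σ ⟨β, right_mem_Icc.2 hβ.le⟩}

/-- The single-site path-integral measure
`μ (dσ) = Z⁻¹ 1_{σ allowed} exp (h • σ) φ (dσ)`. -/
def spinMeasure (hβ : 0 < β) (lam : ℝ) (b : TimeBC) (h : Icc (0 : ℝ) β → ℝ) :
    Measure (SpinPath β) :=
  ((freeLaw β lam).restrict (b.allowed hβ)).tilted (dot h)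

theorem measurable_eval (t : Icc (0 : ℝ) β) : Measurable fun σ : SpinPath β => σ t :=
  (measurable_pi_apply t).comp (comap_measurable _)

theorem freeLaw_univ (hβ : 0 < β) {lam : ℝ} (hl : 0 ≤ lam) : freeLaw β lam univ = 1 := by
  have h2 : ∀ n : ℕ, (∑ ε : ℤˣ, (2⁻¹ : ℝ≥0∞) •
        (Measure.pi fun _ : Fin n => lebesgue β).map (flipPath ε)) univ
        = ENNReal.ofReal (β ^ n) := by
    intro n
    have : ∀ ε : ℤˣ, ((Measure.pi fun _ : Fin n => lebesgue β).map (flipPath ε)) univ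
        = ENNReal.ofReal (β ^ n) := by
      intro ε
      rw [Measure.map_apply (measurable_flipPath ε n) MeasurableSet.univ, preimage_univ,
        Measure.pi_univ]
      simp [lebesgue_univ, ENNReal.ofReal_pow hβ.le]
    simp only [Measure.coe_finsetSum, Finset.sum_apply, Measure.smul_apply, this, smul_eq_mul,
      Finset.sum_const, Finset.card_univ, Fintype.card_units_int, nsmul_eq_mul]
    rw [← mul_assoc]
    simp [ENNReal.mul_inv_cancel]
  rw [freeLaw, Measure.sum_apply _ MeasurableSet.univ]
  simp only [Measure.smul_apply, h2, smul_eq_mul]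
  have hs : HasSum (fun n : ℕ => Real.exp (-(lam * β)) * lam ^ n / n ! * β ^ n) 1 := by
    have := (NormedSpace.expSeries_div_hasSum_exp (lam * β)).mul_left (Real.exp (-(lam * β)))
    rw [← Real.exp_eq_exp_ℝ, ← Real.exp_add, neg_add_cancel, Real.exp_zero] at this
    refine this.congr_fun ?_
    intro n
    rw [mul_pow]; ring
  rw [← ENNReal.ofReal_one, ← hs.tsum_eq, ENNReal.ofReal_tsum_of_nonneg _ hs.summable]
  · congr 1; ext n
    rw [ENNReal.ofReal_mul (by positivity)]
  · intro n; positivity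

theorem measurable_uncurry (hβ : 0 < β) :
    Measurable fun p : SpinPath β × Icc (0 : ℝ) β => p.1 p.2 := by
  let g : ℕ → ℕ → Icc (0 : ℝ) β := fun n k =>
    ⟨min β ((k + 1 : ℝ) / (n + 1)), le_min hβ.le (by positivity), min_le_left _ _⟩
  refine measurable_of_tendsto_metrizable
    (f := fun (n : ℕ) (p : SpinPath β × Icc (0 : ℝ) β) => p.1 (g n ⌊(p.2 : ℝ) * (n + 1)⌋₊))
    (fun n => ?_) (tendsto_pi_nhds.2 fun p => ?_)
  · have h1 : Measurable fun q : SpinPath β × ℕ => q.1 (g n q.2) :=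
      measurable_from_prod_countable_left fun k => measurable_eval (g n k)
    exact h1.comp (measurable_fst.prodMk (Nat.measurable_floor.comp
      ((measurable_subtype_coe.comp measurable_snd).mul_const _)))
  · have hp := p.2.2
    refine (p.1.right_cont p.2).tendsto.comp (tendsto_nhdsWithin_iff.2 ⟨?_, ?_⟩)
    · rw [tendsto_subtype_rng]
      have hu : Tendsto (fun n : ℕ => (p.2 : ℝ) + 1 / ((n : ℝ) + 1)) atTop (𝓝 (p.2 : ℝ)) := by
        simpa using tendsto_const_nhds.add (tendsto_one_div_add_atTop_nhds_zero_nat (𝕜 := ℝ))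
      refine tendsto_of_tendsto_of_tendsto_of_le_of_le tendsto_const_nhds hu ?_ ?_
      · intro n
        refine le_min hp.2 ?_
        rw [le_div_iff₀ (by positivity)]
        exact (Nat.lt_floor_add_one _).le
      · intro n
        refine (min_le_right _ _).trans ?_
        rw [div_le_iff₀ (by positivity), add_mul, one_div, inv_mul_cancel₀ (by positivity)]
        have := Nat.floor_le (show 0 ≤ (p.2 : ℝ) * (n + 1) from mul_nonneg hp.1 (by positivity))
        linarith
    · refine Eventually.of_forall fun n => ?_
      show (p.2 : ℝ) ≤ min β _
      refine le_min hp.2 ?_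
      rw [le_div_iff₀ (by positivity)]
      exact (Nat.lt_floor_add_one _).le

theorem abs_eq_one (σ : SpinPath β) (t : Icc (0 : ℝ) β) : |σ t| = 1 := by
  rcases σ.spin t with h | h <;> simp [h]

theorem stronglyMeasurable_dot (hβ : 0 < β) {h : Icc (0 : ℝ) β → ℝ}
    (hh : Integrable h (lebesgue β)) : StronglyMeasurable (dot h) := by
  have : dot h = fun σ : SpinPath β => ∫ t, hh.1.mk h t * σ t ∂lebesgue β := by
    ext σ
    refine integral_congr_ae ?_
    filter_upwards [hh.1.ae_eq_mk] with t ht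
    rw [ht]
  rw [this]
  refine StronglyMeasurable.integral_prod_right
    (f := fun (σ : SpinPath β) (t : Icc (0 : ℝ) β) => hh.1.mk h t * σ t) ?_
  exact ((hh.1.stronglyMeasurable_mk.measurable.comp measurable_snd).mul
    (measurable_uncurry hβ)).stronglyMeasurable

theorem abs_dot_le (h : Icc (0 : ℝ) β → ℝ) (σ : SpinPath β) :
    |dot h σ| ≤ ∫ t, |h t| ∂lebesgue β := by
  refine (abs_integral_le_integral_abs).trans_eq ?_
  simp [abs_mul, abs_eq_one]

theorem measurableSet_allowed (hβ : 0 < β) (b : TimeBC) :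
    MeasurableSet (b.allowed hβ) := by
  cases b
  · exact MeasurableSet.univ
  · exact measurableSet_eq_fun (measurable_eval _) (measurable_eval _)

theorem freeLaw_allowed_ne_zero (hβ : 0 < β) {lam : ℝ} (b : TimeBC) :
    freeLaw β lam (b.allowed hβ) ≠ 0 := by
  intro h0
  rw [freeLaw, Measure.sum_apply _ (measurableSet_allowed hβ b), ENNReal.tsum_eq_zero] at h0
  have := h0 0
  simp only [Measure.smul_apply, Measure.coe_finsetSum, Finset.sum_apply, smul_eq_mul] at this
  rw [mul_eq_zero, Finset.sum_eq_zero_iff] at this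
  rcases this with h | h
  · simp at h
    linarith [Real.exp_pos (-(lam * β))]
  · have h1 := h 1 (Finset.mem_univ _)
    rw [Measure.map_apply (measurable_flipPath 1 0) (measurableSet_allowed hβ b)] at h1
    have : (flipPath 1 : (Fin 0 → Icc (0 : ℝ) β) → SpinPath β) ⁻¹' (b.allowed hβ) = univ := by
      ext x; cases b <;> simp [TimeBC.allowed, flipPath]
    rw [this] at h1
    simp at h1

/-- The normalization is legitimate: `spinMeasure` is a probability measure. -/
theorem isProbabilityMeasure_spinMeasure (hβ : 0 < β) {lam : ℝ} (hl : 0 ≤ lam) (b : TimeBC)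
    {h : Icc (0 : ℝ) β → ℝ} (hh : Integrable h (lebesgue β)) :
    IsProbabilityMeasure (spinMeasure hβ lam b h) := by
  have : IsProbabilityMeasure (freeLaw β lam) := ⟨freeLaw_univ hβ hl⟩
  have : NeZero ((freeLaw β lam).restrict (b.allowed hβ)) :=
    ⟨by rw [Ne, Measure.restrict_eq_zero]; exact freeLaw_allowed_ne_zero hβ b⟩
  refine isProbabilityMeasure_tilted ?_
  refine Integrable.of_bound (C := Real.exp (∫ t, |h t| ∂lebesgue β))
    (Real.measurable_exp.comp
      (stronglyMeasurable_dot hβ hh).measurable).aestronglyMeasurable ?_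
  refine Eventually.of_forall fun σ => ?_
  rw [Real.norm_eq_abs, Real.abs_exp]
  exact Real.exp_le_exp.2 ((le_abs_self _).trans (abs_dot_le h σ))

/-- `f` is increasing: `f σ ≤ f σ'` whenever `σ t ≤ σ' t` for almost every `t`. -/
def Increasing (f : SpinPath β → ℝ) : Prop :=
  ∀ σ σ' : SpinPath β, (∀ᵐ t ∂lebesgue β, σ t ≤ σ' t) → f σ ≤ f σ'

/-- `ν` is stochastically smaller than `ν'`. (An increasing function takes its values between
those at `minus β` and `plus β`, so for probability measures the integrals converge.) -/
def StochLE (ν ν' : Measure (SpinPath β)) : Prop :=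
  ∀ f : SpinPath β → ℝ, Measurable f → Increasing f → ∫ σ, f σ ∂ν ≤ ∫ σ, f σ ∂ν'

end SpinPath

end

/-! ### A Harris inequality on finite lattices -/

noncomputable section

/-! Put `g = h' - h` and `q σ = exp (dot g σ)`. The difference of the two expectations is `1 / (2 Z
Z')` times the integral, over two independent free spins, of `(f σ - f σ') (q σ - q σ')` weighted by
`exp (dot h σ + dot h σ')` and the boundary indicators (`integral_pairKernel`).

Merge the flips of both spins: the result is a Poisson process whose points are assigned to one spin
or the other by fair coins (`hasSum_integral_freeLaw_prod`). Given the merged points, each one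
reverses the sign of the product of the spins, so this product is known up to a global sign `p`.
Where it is `1` the spins share a sign `a`; elsewhere they are `d` and `-d`. With `p` and `a` fixed,
the spins have a fixed sum, so the exponential weight is constant, while both differences are
increasing and odd in `d`. Harris' inequality makes every such contribution nonnegative
(`sum_pairKernel_mixSigns_nonneg`); the periodic constraint survives because it is stable under `⊓`
and `⊔`.

Keeping only the event of no flips, where the spins are constant, gives the quantitative bound
(`le_integral_pairKernel`). -/

/-- A Harris inequality for two increasing functions that are odd under a symmetry of the
weight. -/
theorem sum_mul_nonneg_of_monotone_of_odd {α : Type*} [DistribLattice α] [Fintype α]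
    (w u v : α → ℝ) (e : α ≃ α) (hw₀ : 0 ≤ w) (hu : Monotone u) (hv : Monotone v)
    (hw : ∀ a b, w a * w b ≤ w (a ⊓ b) * w (a ⊔ b)) (hwe : ∀ a, w (e a) = w a)
    (hue : ∀ a, u (e a) = -u a) (hve : ∀ a, v (e a) = -v a) :
    0 ≤ ∑ a, w a * (u a * v a) := by
  have zero_of_odd : ∀ r : α → ℝ, (∀ a, r (e a) = -r a) → ∑ a, w a * r a = 0 := by
    intro r hr
    have h1 := Equiv.sum_comp e fun a => w a * r a
    simp only [hwe, hr, mul_neg, Finset.sum_neg_distrib] at h1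
    linarith
  have hu0 := zero_of_odd u hue
  have hv0 := zero_of_odd v hve
  -- `fkg` asks for nonnegative functions. Since `u` and `v` have weighted sum zero, the shift by
  -- `C` cancels from the resulting inequality.
  obtain ⟨C, hCu, hCv⟩ : ∃ C : ℝ, (∀ a, 0 ≤ u a + C) ∧ ∀ a, 0 ≤ v a + C := by
    refine ⟨∑ a, (|u a| + |v a|), fun a => ?_, fun a => ?_⟩ <;>
    · have : |u a| + |v a| ≤ _ := Finset.single_le_sum (f := fun a => |u a| + |v a|)
        (fun i _ => by positivity) (Finset.mem_univ a)
      have h1 := neg_abs_le (u a)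
      have h2 := neg_abs_le (v a)
      have h3 := abs_nonneg (u a)
      have h4 := abs_nonneg (v a)
      linarith
  have key := fkg (fun a => u a + C) (fun a => v a + C) w hw₀ hCu hCv
    (fun a b h => by have := hu h; simp only; linarith)
    (fun a b h => by have := hv h; simp only; linarith) hw
  have e1 : ∑ a, w a * (u a + C) = C * ∑ a, w a := by
    simp only [mul_add, Finset.sum_add_distrib, hu0, zero_add, Finset.mul_sum]
    exact Finset.sum_congr rfl fun a _ => by ring
  have e2 : ∑ a, w a * (v a + C) = C * ∑ a, w a := by
    simp only [mul_add, Finset.sum_add_distrib, hv0, zero_add, Finset.mul_sum]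
    exact Finset.sum_congr rfl fun a _ => by ring
  have e3 : ∑ a, w a * ((u a + C) * (v a + C)) = ∑ a, w a * (u a * v a) + C ^ 2 * ∑ a, w a := by
    have : ∀ a, w a * ((u a + C) * (v a + C))
        = w a * (u a * v a) + C * (w a * u a) + C * (w a * v a) + C ^ 2 * w a := by
      intro a; ring
    simp only [this, Finset.sum_add_distrib, ← Finset.mul_sum, hu0, hv0]
    ring
  rw [e1, e2, e3] at key
  rcases (Finset.sum_nonneg fun a _ => hw₀ a : (0 : ℝ) ≤ ∑ a, w a).eq_or_lt with h0 | hpos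
  · have hz := (Finset.sum_eq_zero_iff_of_nonneg fun a _ => hw₀ a).1 h0.symm
    exact (Finset.sum_eq_zero fun a ha => by simp only [hz a ha, zero_mul]).ge
  · refine nonneg_of_mul_nonneg_right (a := ∑ a, w a) ?_ hpos
    nlinarith

namespace SpinPath

variable {β : ℝ} {n : ℕ}

/-! ### Pairs of step paths with a prescribed product -/

/-- The number of points `x i` in `[0, t]`. -/
def countLE (x : Fin n → Icc (0 : ℝ) β) (t : Icc (0 : ℝ) β) : Fin (n + 1) :=
  ⟨(Finset.univ.filter fun i => x i ≤ t).card,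
    Nat.lt_succ_of_le ((Finset.card_le_univ _).trans_eq (Fintype.card_fin n))⟩

/-- The path that takes the value `τ k` once `k` of the points `x i` have been passed. -/
def stepPath (x : Fin n → Icc (0 : ℝ) β) (τ : Fin (n + 1) → ℤˣ) : SpinPath β where
  toFun t := ((τ (countLE x t) : ℤ) : ℝ)
  spin t := by rcases Int.units_eq_one_or (τ (countLE x t)) with h | h <;> simp [h]
  right_cont t := by
    refine tendsto_const_nhds.congr' ?_
    filter_upwards [eventually_count_right x t] with s hs
    simp only [countLE, hs]
  left_lim t := by
    refine ⟨((τ ⟨(Finset.univ.filter fun i => x i < t).card, Nat.lt_succ_of_le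
      ((Finset.card_le_univ _).trans_eq (Fintype.card_fin n))⟩ : ℤ) : ℝ),
      tendsto_const_nhds.congr' ?_⟩
    filter_upwards [eventually_count_left x t] with s hs
    simp only [countLE, hs]

theorem stepPath_apply (x : Fin n → Icc (0 : ℝ) β) (τ : Fin (n + 1) → ℤˣ)
    (t : Icc (0 : ℝ) β) : stepPath x τ t = ((τ (countLE x t) : ℤ) : ℝ) := rfl

theorem monotone_unitsToReal : Monotone fun u : ℤˣ => ((u : ℤ) : ℝ) :=
  fun _ _ h => Int.cast_le.2 (Units.val_le_val.2 h)

/-- The signs equal to `a` at the indices `k` with `p (-1) ^ k = 1` and to `d` at the others. -/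
def mixSigns (p : ℤˣ) (a d : Fin n → ℤˣ) : Fin n → ℤˣ := fun k =>
  if p * (-1) ^ (k : ℕ) = 1 then a k else d k

/-- Exchanging `a` and `d` at the indices where the product is `-1` is an involution on pairs, and
its first component is `mixSigns`. The other component is free, whence the cardinality. -/
theorem sum_sum_mixSigns (p : ℤˣ) (Q : (Fin n → ℤˣ) → ℝ) :
    ∑ a, ∑ d, Q (mixSigns p a d) = Fintype.card (Fin n → ℤˣ) * ∑ τ, Q τ := by
  let e : (Fin n → ℤˣ) × (Fin n → ℤˣ) ≃ (Fin n → ℤˣ) × (Fin n → ℤˣ) :=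
    Function.Involutive.toPerm (fun q => (mixSigns p q.1 q.2, mixSigns p q.2 q.1)) (by
      rintro ⟨a, d⟩
      refine Prod.ext (funext fun k => ?_) (funext fun k => ?_) <;>
      · by_cases hk : p * (-1) ^ (k : ℕ) = 1 <;> simp [mixSigns, hk])
  have h := Equiv.sum_comp e fun q => Q q.1
  rw [Fintype.sum_prod_type, Fintype.sum_prod_type] at h
  refine h.trans ?_
  simp [Finset.mul_sum]

theorem mul_mixSigns (p : ℤˣ) (a d : Fin n → ℤˣ) :
    (fun k : Fin n => p * (-1) ^ (k : ℕ) * mixSigns p a d k) = mixSigns p a (-d) := by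
  funext k
  rcases Int.units_eq_one_or (p * (-1) ^ (k : ℕ)) with hk | hk <;> simp [mixSigns, hk]

theorem mixSigns_mono (p : ℤˣ) (a : Fin n → ℤˣ) : Monotone (mixSigns p a) := by
  intro d d' h k
  by_cases hk : p * (-1) ^ (k : ℕ) = 1 <;> simp [mixSigns, hk, h k]

theorem mixSigns_sup (p : ℤˣ) (a d d' : Fin n → ℤˣ) :
    mixSigns p a (d ⊔ d') = mixSigns p a d ⊔ mixSigns p a d' := by
  funext k
  by_cases hk : p * (-1) ^ (k : ℕ) = 1 <;> simp [mixSigns, hk]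

theorem mixSigns_inf (p : ℤˣ) (a d d' : Fin n → ℤˣ) :
    mixSigns p a (d ⊓ d') = mixSigns p a d ⊓ mixSigns p a d' := by
  funext k
  by_cases hk : p * (-1) ^ (k : ℕ) = 1 <;> simp [mixSigns, hk]

theorem neg_sup_signs (d d' : Fin n → ℤˣ) : -(d ⊔ d') = -d ⊓ -d' := by
  have : ∀ u v : ℤˣ, -(u ⊔ v) = -u ⊓ -v := by decide
  exact funext fun k => this (d k) (d' k)

theorem neg_inf_signs (d d' : Fin n → ℤˣ) : -(d ⊓ d') = -d ⊔ -d' := by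
  have : ∀ u v : ℤˣ, -(u ⊓ v) = -u ⊔ -v := by decide
  exact funext fun k => this (d k) (d' k)

theorem neg_le_neg_signs {d d' : Fin n → ℤˣ} (h : d ≤ d') : -d' ≤ -d := by
  have : ∀ u v : ℤˣ, u ≤ v → -v ≤ -u := by decide
  exact fun k => this _ _ (h k)

/-- The periodic condition equates two coordinates of `τ`, so it passes to pointwise suprema. This
and its dual give the lattice condition on the weight. -/
theorem stepPath_sup_mem_allowed (hβ : 0 < β) (b : TimeBC) (x : Fin n → Icc (0 : ℝ) β)
    {τ τ' : Fin (n + 1) → ℤˣ} (h : stepPath x τ ∈ b.allowed hβ)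
    (h' : stepPath x τ' ∈ b.allowed hβ) : stepPath x (τ ⊔ τ') ∈ b.allowed hβ := by
  cases b
  · trivial
  · simp only [TimeBC.allowed, mem_ofPred_eq, stepPath_apply, Pi.sup_apply, Int.cast_inj,
      Units.val_inj] at h h' ⊢
    rw [h, h']

theorem stepPath_inf_mem_allowed (hβ : 0 < β) (b : TimeBC) (x : Fin n → Icc (0 : ℝ) β)
    {τ τ' : Fin (n + 1) → ℤˣ} (h : stepPath x τ ∈ b.allowed hβ)
    (h' : stepPath x τ' ∈ b.allowed hβ) : stepPath x (τ ⊓ τ') ∈ b.allowed hβ := by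
  cases b
  · trivial
  · simp only [TimeBC.allowed, mem_ofPred_eq, stepPath_apply, Pi.inf_apply, Int.cast_inj,
      Units.val_inj] at h h' ⊢
    rw [h, h']

/-- The symmetrized covariance density of `f` and `q` at a pair of allowed paths with weights
`w`. -/
def pairKernel (A : Set (SpinPath β)) (w f q : SpinPath β → ℝ) (σ σ' : SpinPath β) : ℝ :=
  A.indicator w σ * A.indicator w σ' * ((f σ - f σ') * (q σ - q σ'))

/-- `f` is increasing for the pointwise order of paths. -/
def PointwiseMono (f : SpinPath β → ℝ) : Prop :=
  ∀ σ σ' : SpinPath β, (∀ t, σ t ≤ σ' t) → f σ ≤ f σ'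

/-- `w σ * w σ'` depends only on `σ + σ'`. -/
def PairWeight (w : SpinPath β → ℝ) : Prop :=
  ∀ σ σ' ρ ρ' : SpinPath β, (∀ t, σ t + σ' t = ρ t + ρ' t) → w σ * w σ' = w ρ * w ρ'

/-- Harris' inequality in the variable `d`, for the symmetry `d ↦ -d` that exchanges the two paths.
-/
theorem sum_pairKernel_mixSigns_nonneg (hβ : 0 < β) (b : TimeBC) {w f q : SpinPath β → ℝ}
    (hw₀ : ∀ σ, 0 ≤ w σ) (hw : PairWeight w) (hf : PointwiseMono f) (hq : PointwiseMono q)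
    (x : Fin n → Icc (0 : ℝ) β) (p : ℤˣ) (a : Fin (n + 1) → ℤˣ) :
    0 ≤ ∑ d, pairKernel (b.allowed hβ) w f q
      (stepPath x (mixSigns p a d)) (stepPath x (mixSigns p a (-d))) := by
  set A := b.allowed hβ
  set P : (Fin (n + 1) → ℤˣ) → SpinPath β := fun d => stepPath x (mixSigns p a d) with hP
  have hPmono : ∀ {d d'}, d ≤ d' → ∀ t, P d t ≤ P d' t := fun h t =>
    monotone_unitsToReal (mixSigns_mono p a h _)
  have hodd : ∀ r : SpinPath β → ℝ, PointwiseMono r →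
      Monotone fun d => r (P d) - r (P (-d)) := fun r hr d d' h =>
    sub_le_sub (hr _ _ (hPmono h)) (hr _ _ (hPmono (neg_le_neg_signs h)))
  have hsum : ∀ d t, P d t + P (-d) t = P 1 t + P (-1) t := by
    intro d t
    simp only [hP, stepPath_apply, mixSigns]
    split_ifs <;> simp
  set c := w (P 1) * w (P (-1))
  have hc : 0 ≤ c := mul_nonneg (hw₀ _) (hw₀ _)
  have hcd : ∀ d, w (P d) * w (P (-d)) = c := fun d => hw _ _ _ _ (hsum d)
  -- `W` is `c` times the indicator that both paths are allowed, so log-supermodularity only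
  -- requires that this set of `d` be a sublattice.
  set W : (Fin (n + 1) → ℤˣ) → ℝ := fun d => A.indicator w (P d) * A.indicator w (P (-d))
  have hWin : ∀ d, P d ∈ A → P (-d) ∈ A → W d = c := fun d h h' => by
    simp only [W, indicator_of_mem h, indicator_of_mem h', hcd]
  have hW0 : ∀ d, 0 ≤ W d := fun d =>
    mul_nonneg (indicator_nonneg (fun σ _ => hw₀ σ) _) (indicator_nonneg (fun σ _ => hw₀ σ) _)
  refine sum_mul_nonneg_of_monotone_of_odd W (fun d => f (P d) - f (P (-d)))
    (fun d => q (P d) - q (P (-d))) (Equiv.neg _) hW0 (hodd f hf) (hodd q hq) ?_ ?_ ?_ ?_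
  · intro d d'
    by_cases h : (P d ∈ A ∧ P (-d) ∈ A) ∧ P d' ∈ A ∧ P (-d') ∈ A
    · obtain ⟨⟨h1, h2⟩, h3, h4⟩ := h
      rw [hWin d h1 h2, hWin d' h3 h4, hWin (d ⊓ d'), hWin (d ⊔ d')]
      · simp only [hP, mixSigns_sup]
        exact stepPath_sup_mem_allowed hβ b x h1 h3
      · simp only [hP, neg_sup_signs, mixSigns_inf]
        exact stepPath_inf_mem_allowed hβ b x h2 h4
      · simp only [hP, mixSigns_inf]
        exact stepPath_inf_mem_allowed hβ b x h1 h3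
      · simp only [hP, neg_inf_signs, mixSigns_sup]
        exact stepPath_sup_mem_allowed hβ b x h2 h4
    · have : W d * W d' = 0 := by
        simp only [W, mul_eq_zero, indicator_apply_eq_zero]
        by_contra! h'
        exact h ⟨⟨h'.1.1.1, h'.1.2.1⟩, h'.2.1.1, h'.2.2.1⟩
      rw [this]
      exact mul_nonneg (hW0 _) (hW0 _)
  · intro d; simp only [W, Equiv.neg_apply, neg_neg, mul_comm]
  · intro d; simp
  · intro d; simp

/-- Summing over `a` as well reaches each `τ` equally often, and by `mul_mixSigns` the partner of
`mixSigns p a d` is `mixSigns p a (-d)`. -/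
theorem sum_pairKernel_stepPath_nonneg (hβ : 0 < β) (b : TimeBC) {w f q : SpinPath β → ℝ}
    (hw₀ : ∀ σ, 0 ≤ w σ) (hw : PairWeight w) (hf : PointwiseMono f) (hq : PointwiseMono q)
    (x : Fin n → Icc (0 : ℝ) β) (p : ℤˣ) :
    0 ≤ ∑ τ : Fin (n + 1) → ℤˣ, pairKernel (b.allowed hβ) w f q
      (stepPath x τ) (stepPath x fun k => p * (-1) ^ (k : ℕ) * τ k) := by
  have h := sum_sum_mixSigns p fun τ : Fin (n + 1) → ℤˣ => pairKernel (b.allowed hβ) w f q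
      (stepPath x τ) (stepPath x fun k => p * (-1) ^ (k : ℕ) * τ k)
  simp only [mul_mixSigns] at h
  refine nonneg_of_mul_nonneg_right (h ▸ Finset.sum_nonneg fun a _ =>
    sum_pairKernel_mixSigns_nonneg hβ b hw₀ hw hf hq x p a) ?_
  exact_mod_cast Fintype.card_pos

/-! ### Splitting given flip points between two paths -/

/-- The path that starts from `ε` and flips at the points `x i` with `i ∈ S`. -/
def flipOn (ε : ℤˣ) (x : Fin n → Icc (0 : ℝ) β) (S : Finset (Fin n)) : SpinPath β :=
  flipPath ε fun j => x (S.orderEmbOfFin rfl j)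

theorem flipOn_apply (ε : ℤˣ) (x : Fin n → Icc (0 : ℝ) β) (S : Finset (Fin n))
    (t : Icc (0 : ℝ) β) :
    flipOn ε x S t = ((ε : ℤ) : ℝ) * (-1) ^ (S.filter fun i => x i ≤ t).card := by
  have : (S.filter fun i => x i ≤ t).card =
      (Finset.univ.filter fun j => x (S.orderEmbOfFin rfl j) ≤ t).card := by
    rw [← Finset.card_map (S.orderEmbOfFin rfl).toEmbedding]
    congr 1
    ext i
    simp only [Finset.mem_filter, Finset.mem_map, Finset.mem_univ, true_and]
    constructor
    · rintro ⟨hi, h⟩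
      have : i ∈ Set.range (S.orderEmbOfFin rfl) := by
        rw [Finset.range_orderEmbOfFin]; exact hi
      obtain ⟨j, rfl⟩ := this
      exact ⟨j, h, rfl⟩
    · rintro ⟨j, h, rfl⟩
      exact ⟨Finset.orderEmbOfFin_mem _ _ _, h⟩
  rw [this]
  rfl

/-- The signs of the path that starts from `ε` and flips at the points with index in `S`, for
sorted points. -/
def flipSigns (q : ℤˣ × Finset (Fin n)) : Fin (n + 1) → ℤˣ := fun k =>
  q.1 * (-1) ^ (q.2.filter fun i => i.castSucc < k).card

theorem flipSigns_succ (q : ℤˣ × Finset (Fin n)) (i : Fin n) :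
    flipSigns q i.succ = flipSigns q i.castSucc * if i ∈ q.2 then -1 else 1 := by
  have h : (q.2.filter fun j => j.castSucc < i.succ) =
      (q.2.filter fun j => j.castSucc < i.castSucc) ∪ (q.2.filter fun j => j = i) := by
    ext j
    simp only [Finset.mem_filter, Finset.mem_union, Fin.lt_def, Fin.ext_iff, Fin.val_succ,
      Fin.val_castSucc, Nat.lt_succ_iff_lt_or_eq]
    tauto
  have hd : Disjoint (q.2.filter fun j => j.castSucc < i.castSucc)
      (q.2.filter fun j => j = i) := by
    rw [Finset.disjoint_left]
    simp only [Finset.mem_filter, not_and]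
    rintro j ⟨-, h⟩ - rfl
    exact lt_irrefl _ h
  simp only [flipSigns, h, Finset.card_union_of_disjoint hd, pow_add]
  rw [Finset.filter_eq', mul_assoc]
  split_ifs <;> simp

/-- The sign at index `0` recovers `ε`, and comparing consecutive signs recovers membership in `S`;
both sides have `2 ^ (n + 1)` elements. -/
theorem flipSigns_bijective : Function.Bijective (flipSigns (n := n)) := by
  rw [Fintype.bijective_iff_injective_and_card]
  constructor
  · rintro ⟨ε, S⟩ ⟨ε', S'⟩ h
    refine Prod.ext ?_ (Finset.ext fun i => ?_)
    · simpa [flipSigns] using congrFun h 0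
    · have h1 := congrFun h i.succ
      rw [flipSigns_succ, flipSigns_succ, congrFun h i.castSucc] at h1
      have h2 := mul_left_cancel h1
      dsimp only at h2 ⊢
      by_cases hi : i ∈ S <;> by_cases hi' : i ∈ S' <;> simp [hi, hi'] at h2 ⊢
  · simp [pow_succ, mul_comm]

/-- For sorted points, those already passed at time `t` form an initial segment of the indices. -/
theorem le_iff_lt_countLE {x : Fin n → Icc (0 : ℝ) β} (hx : Monotone x) (i : Fin n)
    (t : Icc (0 : ℝ) β) : x i ≤ t ↔ i.castSucc < countLE x t := by
  rw [Fin.lt_def, Fin.val_castSucc]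
  simp only [countLE]
  constructor
  · intro h
    have : Finset.Iic i ⊆ Finset.univ.filter fun j => x j ≤ t := fun j hj => by
      simpa using (hx (Finset.mem_Iic.1 hj)).trans h
    have := Finset.card_le_card this
    rw [Fin.card_Iic] at this
    omega
  · intro h
    by_contra hi
    have : (Finset.univ.filter fun j => x j ≤ t) ⊆ Finset.Iio i := fun j hj => by
      simp only [Finset.mem_filter, Finset.mem_univ, true_and] at hj
      exact Finset.mem_Iio.2 (lt_of_not_ge fun hij => hi ((hx hij).trans hj))
    have := Finset.card_le_card this
    rw [Fin.card_Iio] at this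
    omega

theorem flipOn_eq_stepPath {x : Fin n → Icc (0 : ℝ) β} (hx : Monotone x) (ε : ℤˣ)
    (S : Finset (Fin n)) : flipOn ε x S = stepPath x (flipSigns (ε, S)) := by
  refine SpinPath.ext (funext fun t => ?_)
  rw [flipOn_apply]
  simp [stepPath, flipSigns, le_iff_lt_countLE hx]

/-- Among the first `k` points, those in `S` and those in `Sᶜ` number `k` together, so the product
of the two sign sequences does not depend on `S`. -/
theorem flipSigns_compl (ε p : ℤˣ) (S : Finset (Fin n)) :
    flipSigns (p * ε, Sᶜ) = fun k : Fin (n + 1) => p * (-1) ^ (k : ℕ) * flipSigns (ε, S) k := by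
  funext k
  have h : (Sᶜ.filter fun i => i.castSucc < k).card + (S.filter fun i => i.castSucc < k).card
      = k := by
    rw [← Finset.card_union_of_disjoint
      (Finset.disjoint_filter_filter disjoint_compl_left), ← Finset.filter_union,
      Finset.union_comm, Finset.union_compl]
    simp only [Fin.lt_def, Fin.val_castSucc, Fin.card_filter_val_lt]
    omega
  simp only [flipSigns]
  conv_rhs => rw [← h, pow_add]
  generalize (S.filter fun i => i.castSucc < k).card = m
  generalize (Sᶜ.filter fun i => i.castSucc < k).card = m'
  have : ((-1 : ℤˣ) ^ m) * (-1) ^ m = 1 := by rw [← mul_pow]; simp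
  calc p * ε * (-1) ^ m' = p * ε * (-1) ^ m' * ((-1) ^ m * (-1) ^ m) := by
        rw [this, mul_one]
    _ = _ := by simp only [mul_assoc, mul_comm, mul_left_comm]

/-- Relabelling the points permutes the subsets and respects complements; this allows the points to
be sorted. -/
theorem sum_flipOn_comp_perm (K : SpinPath β → SpinPath β → ℝ) (π : Equiv.Perm (Fin n))
    (x : Fin n → Icc (0 : ℝ) β) (ε ε' : ℤˣ) :
    ∑ S : Finset (Fin n), K (flipOn ε (x ∘ π) S) (flipOn ε' (x ∘ π) Sᶜ) =
      ∑ S : Finset (Fin n), K (flipOn ε x S) (flipOn ε' x Sᶜ) := by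
  have h : ∀ (ε : ℤˣ) (S : Finset (Fin n)),
      flipOn ε (x ∘ π) S = flipOn ε x (S.map π.toEmbedding) := by
    intro ε S
    refine SpinPath.ext (funext fun t => ?_)
    rw [flipOn_apply, flipOn_apply, Finset.filter_map, Finset.card_map]
    rfl
  conv_rhs => rw [← Equiv.sum_comp π.finsetCongr]
  refine Finset.sum_congr rfl fun S _ => ?_
  rw [h, h, Equiv.finsetCongr_apply]
  congr 2
  ext i
  simp [Finset.mem_map_equiv]

theorem sum_pairKernel_flipOn_nonneg (hβ : 0 < β) (b : TimeBC) {w f q : SpinPath β → ℝ}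
    (hw₀ : ∀ σ, 0 ≤ w σ) (hw : PairWeight w) (hf : PointwiseMono f) (hq : PointwiseMono q)
    (x : Fin n → Icc (0 : ℝ) β) :
    0 ≤ ∑ ε : ℤˣ, ∑ ε' : ℤˣ, ∑ S : Finset (Fin n),
      pairKernel (b.allowed hβ) w f q (flipOn ε x S) (flipOn ε' x Sᶜ) := by
  have hmono := Tuple.monotone_sort x
  simp only [← sum_flipOn_comp_perm (pairKernel (b.allowed hβ) w f q) (Tuple.sort x) x]
  set y := x ∘ Tuple.sort x
  have h1 : ∀ ε : ℤˣ, ∑ ε' : ℤˣ, ∑ S : Finset (Fin n),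
      pairKernel (b.allowed hβ) w f q (flipOn ε y S) (flipOn ε' y Sᶜ) =
      ∑ p : ℤˣ, ∑ S : Finset (Fin n),
      pairKernel (b.allowed hβ) w f q (flipOn ε y S) (flipOn (p * ε) y Sᶜ) := fun ε =>
    -- The substitution `ε' = p * ε` makes `p` the initial product of the two paths.
    (Equiv.sum_comp (Equiv.mulRight ε) _).symm
  simp only [h1]
  rw [Finset.sum_comm]
  refine Finset.sum_nonneg fun p _ => ?_
  rw [← Fintype.sum_prod_type']
  refine (sum_pairKernel_stepPath_nonneg hβ b hw₀ hw hf hq y p).trans_eq ?_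
  rw [← Equiv.sum_comp (Equiv.ofBijective _ flipSigns_bijective)]
  refine Finset.sum_congr rfl fun r _ => ?_
  rw [flipOn_eq_stepPath hmono, flipOn_eq_stepPath hmono, flipSigns_compl]
  rfl

end SpinPath

end

/-! ### Superposition of two independent flip processes -/

noncomputable section

namespace SpinPath

variable {β : ℝ} {n : ℕ}

/-- The law of `n` independent uniform points, without normalization. -/
abbrev pointLaw (β : ℝ) (n : ℕ) : Measure (Fin n → Icc (0 : ℝ) β) :=
  Measure.pi fun _ => lebesgue β

/-- The coordinates in `S` and in `Sᶜ` are independent under the product measure, so only the two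
cardinalities matter. -/
theorem integral_flipOn (K : SpinPath β → SpinPath β → ℝ) (ε ε' : ℤˣ) {i j : ℕ}
    (S : Finset (Fin n)) (hi : S.card = i) (hj : Sᶜ.card = j) :
    ∫ x, K (flipOn ε x S) (flipOn ε' x Sᶜ) ∂pointLaw β n =
      ∫ z, K (flipPath ε z.1) (flipPath ε' z.2) ∂(pointLaw β i).prod (pointLaw β j) := by
  subst hi hj
  let e := finSumEquivOfFinset (s := S) rfl rfl
  have h1 := measurePreserving_arrowCongr' (fun _ : Fin n => lebesgue β)
    (fun _ : Fin S.card ⊕ Fin Sᶜ.card => lebesgue β) e.symm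
    (MeasurableEquiv.refl _) (fun _ => MeasurePreserving.id _)
  have h2 := measurePreserving_sumPiEquivProdPi
    (fun _ : Fin S.card ⊕ Fin Sᶜ.card => lebesgue β)
  rw [← h2.integral_comp', ← h1.integral_comp']
  refine integral_congr_ae (Eventually.of_forall fun x => ?_)
  rfl

theorem integrable_of_abs_le {α : Type*} [MeasurableSpace α] {μ : Measure α} [IsFiniteMeasure μ]
    {G : α → ℝ} (hG : Measurable G) {C : ℝ} (hC : ∀ a, |G a| ≤ C) : Integrable G μ :=
  Integrable.of_bound hG.aestronglyMeasurable C (Eventually.of_forall hC)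

/-- The sum over the pairs of paths whose flips are a splitting of the points `x i`. -/
def splitSum (K : SpinPath β → SpinPath β → ℝ) (x : Fin n → Icc (0 : ℝ) β) : ℝ :=
  ∑ ε : ℤˣ, ∑ ε' : ℤˣ, ∑ S : Finset (Fin n), K (flipOn ε x S) (flipOn ε' x Sᶜ)

/-- The integral over independent points of the two paths. -/
def pairIntegral (K : SpinPath β → SpinPath β → ℝ) (i j : ℕ) : ℝ :=
  ∑ ε : ℤˣ, ∑ ε' : ℤˣ,
    ∫ z, K (flipPath ε z.1) (flipPath ε' z.2) ∂(pointLaw β i).prod (pointLaw β j)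

theorem measurable_flipOn (ε : ℤˣ) (S : Finset (Fin n)) :
    Measurable fun x : Fin n → Icc (0 : ℝ) β => flipOn ε x S :=
  (measurable_flipPath ε _).comp (measurable_pi_iff.2 fun _ => measurable_pi_apply _)

theorem integral_splitSum {K : SpinPath β → SpinPath β → ℝ}
    (hK : Measurable (Function.uncurry K)) {C : ℝ} (hC : ∀ σ σ', |K σ σ'| ≤ C) :
    ∫ x, splitSum K x ∂pointLaw β n =
      ∑ ij ∈ Finset.HasAntidiagonal.antidiagonal n, (n.choose ij.1 : ℝ) * pairIntegral K ij.1 ij.2 := by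
  have hint : ∀ (ε ε' : ℤˣ) (S : Finset (Fin n)),
      Integrable (fun x => K (flipOn ε x S) (flipOn ε' x Sᶜ)) (pointLaw β n) := fun ε ε' S =>
    integrable_of_abs_le (hK.comp ((measurable_flipOn ε S).prodMk (measurable_flipOn ε' Sᶜ)))
      fun _ => hC _ _
  simp only [splitSum]
  rw [integral_finsetSum _ fun ε _ => integrable_finsetSum _ fun ε' _ =>
    integrable_finsetSum _ fun S _ => hint ε ε' S]
  simp only [pairIntegral, Finset.mul_sum]
  rw [Finset.sum_comm]
  refine Finset.sum_congr rfl fun ε _ => ?_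
  rw [integral_finsetSum _ fun ε' _ => integrable_finsetSum _ fun S _ => hint ε ε' S,
    Finset.sum_comm]
  refine Finset.sum_congr rfl fun ε' _ => ?_
  rw [integral_finsetSum _ fun S _ => hint ε ε' S,
    Finset.Nat.sum_antidiagonal_eq_sum_range_succ_mk, ← Finset.powerset_univ]
  have := Finset.sum_powerset_apply_card (x := (Finset.univ : Finset (Fin n)))
    fun i => ∫ z, K (flipPath ε z.1) (flipPath ε' z.2)
      ∂(pointLaw β i).prod (pointLaw β (n - i))
  simp only [Finset.card_univ, Fintype.card_fin, nsmul_eq_mul] at this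
  rw [Nat.succ_eq_add_one, ← this]
  refine Finset.sum_congr rfl fun S _ => integral_flipOn K ε ε' S rfl ?_
  rw [Finset.card_compl, Fintype.card_fin]

/-- The contribution to `freeLaw` of the paths with `n` flips. -/
def flipLaw (β lam : ℝ) (n : ℕ) : Measure (SpinPath β) :=
  ENNReal.ofReal (Real.exp (-(lam * β)) * lam ^ n / n !) •
    ∑ ε : ℤˣ, (2⁻¹ : ℝ≥0∞) • (pointLaw β n).map (flipPath ε)

instance (lam : ℝ) : IsFiniteMeasure (flipLaw β lam n) := by
  have : ∀ ε : ℤˣ, IsFiniteMeasure ((2⁻¹ : ℝ≥0∞) • (pointLaw β n).map (flipPath ε)) := fun ε =>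
    Measure.smul_finite _ (by simp)
  exact Measure.smul_finite (∑ ε : ℤˣ, (2⁻¹ : ℝ≥0∞) • (pointLaw β n).map (flipPath ε))
    ENNReal.ofReal_ne_top

theorem integral_flipLaw {lam : ℝ} (hl : 0 ≤ lam) {G : SpinPath β → ℝ} (hG : Measurable G)
    {C : ℝ} (hC : ∀ σ, |G σ| ≤ C) :
    ∫ σ, G σ ∂flipLaw β lam n = Real.exp (-(lam * β)) * lam ^ n / n ! * 2⁻¹ *
      ∑ ε : ℤˣ, ∫ x, G (flipPath ε x) ∂pointLaw β n := by
  have hfin : ∀ ε : ℤˣ, IsFiniteMeasure ((2⁻¹ : ℝ≥0∞) • (pointLaw β n).map (flipPath ε)) :=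
    fun ε => Measure.smul_finite _ (by simp)
  rw [flipLaw, integral_smul_measure, integral_finsetSum_measure fun ε _ =>
    integrable_of_abs_le hG hC, ENNReal.toReal_ofReal (by positivity), smul_eq_mul, mul_assoc,
    Finset.mul_sum _ _ (2⁻¹ : ℝ)]
  congr 1
  refine Finset.sum_congr rfl fun ε _ => ?_
  rw [integral_smul_measure, integral_map (measurable_flipPath ε n).aemeasurable
    hG.aestronglyMeasurable]
  simp

theorem integral_flipLaw_prod {lam : ℝ} (hl : 0 ≤ lam) {K : SpinPath β → SpinPath β → ℝ}
    (hK : Measurable (Function.uncurry K)) {C : ℝ} (hC : ∀ σ σ', |K σ σ'| ≤ C) (i j : ℕ) :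
    ∫ z, K z.1 z.2 ∂(flipLaw β lam i).prod (flipLaw β lam j) =
      Real.exp (-(lam * β)) ^ 2 * lam ^ (i + j) / (i ! * j !) * 4⁻¹ * pairIntegral K i j := by
  have hKr : ∀ σ, Measurable (K σ) := fun σ => hK.comp measurable_prodMk_left
  rw [integral_prod (fun z : SpinPath β × SpinPath β => K z.1 z.2)
    (integrable_of_abs_le hK fun z => hC z.1 z.2)]
  have hin : ∀ σ, |∫ σ', K σ σ' ∂flipLaw β lam j| ≤ C * (flipLaw β lam j).real univ := fun σ => by
    simpa only [Real.norm_eq_abs] using norm_integral_le_of_norm_le_const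
      (μ := flipLaw β lam j) (Eventually.of_forall fun σ' => (Real.norm_eq_abs _).trans_le (hC σ σ'))
  rw [integral_flipLaw hl (hK.stronglyMeasurable.integral_prod_right).measurable hin]
  have hpair : pairIntegral K i j = ∑ ε : ℤˣ, ∫ x,
      ∑ ε' : ℤˣ, ∫ y, K (flipPath ε x) (flipPath ε' y) ∂pointLaw β j ∂pointLaw β i := by
    refine Finset.sum_congr rfl fun ε _ => ?_
    have hint : ∀ ε' : ℤˣ, Integrable (fun z : (Fin i → Icc (0 : ℝ) β) × (Fin j → Icc (0 : ℝ) β) =>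
        K (flipPath ε z.1) (flipPath ε' z.2)) ((pointLaw β i).prod (pointLaw β j)) := fun ε' =>
      integrable_of_abs_le (hK.comp (((measurable_flipPath ε i).comp measurable_fst).prodMk
        ((measurable_flipPath ε' j).comp measurable_snd))) fun _ => hC _ _
    rw [integral_finsetSum _ fun ε' _ => (hint ε').integral_prod_left]
    exact Finset.sum_congr rfl fun ε' _ => integral_prod _ (hint ε')
  have hinner : ∀ σ, ∫ σ', K σ σ' ∂flipLaw β lam j = Real.exp (-(lam * β)) * lam ^ j / j ! * 2⁻¹ *
      ∑ ε : ℤˣ, ∫ y, K σ (flipPath ε y) ∂pointLaw β j := fun σ =>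
    integral_flipLaw hl (hKr σ) (hC σ)
  simp only [hinner, integral_const_mul, hpair, ← Finset.mul_sum]
  rw [pow_add]
  have hi := Nat.factorial_ne_zero i
  have hj := Nat.factorial_ne_zero j
  field_simp
  ring

/-- Two independent free spins: merging the flips gives a Poisson process, each point of which
is assigned to one of the two spins. -/
theorem hasSum_integral_freeLaw_prod (hβ : 0 < β) {lam : ℝ} (hl : 0 ≤ lam)
    {K : SpinPath β → SpinPath β → ℝ}
    (hK : Measurable (Function.uncurry K)) {C : ℝ} (hC : ∀ σ σ', |K σ σ'| ≤ C) :
    HasSum (fun n : ℕ => Real.exp (-(lam * β)) ^ 2 * lam ^ n / n ! * 4⁻¹ *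
        ∫ x, splitSum K x ∂pointLaw β n)
      (∫ z, K z.1 z.2 ∂(freeLaw β lam).prod (freeLaw β lam)) := by
  have : IsProbabilityMeasure (freeLaw β lam) := ⟨freeLaw_univ hβ hl⟩
  have hint : Integrable (fun z : SpinPath β × SpinPath β => K z.1 z.2)
      ((freeLaw β lam).prod (freeLaw β lam)) := integrable_of_abs_le hK fun z => hC z.1 z.2
  have hprod : (freeLaw β lam).prod (freeLaw β lam) =
      Measure.sum fun p : ℕ × ℕ => (flipLaw β lam p.1).prod (flipLaw β lam p.2) :=
    Measure.prod_sum (flipLaw β lam) (flipLaw β lam)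
  rw [hprod] at hint ⊢
  have hs := hasSum_integral_measure hint
  -- Group the pairs `(i, j)` by the total number of flips; `1 / (i! j!)` is then `choose / n!`,
  -- which counts the splittings of `n` points.
  rw [← Finset.HasAntidiagonal.sigmaAntidiagonalEquivProd.hasSum_iff] at hs
  have := hs.sigma fun n => hasSum_fintype _
  refine this.congr_fun fun n => ?_
  rw [integral_splitSum hK hC, Finset.mul_sum, Finset.univ_eq_attach,
    ← Finset.sum_attach (Finset.HasAntidiagonal.antidiagonal n)]
  refine Finset.sum_congr rfl fun ⟨ij, hij⟩ _ => ?_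
  change _ * ((n.choose ij.1 : ℝ) * pairIntegral K ij.1 ij.2) = ∫ z, K z.1 z.2 ∂(flipLaw β lam ij.1).prod (flipLaw β lam ij.2)
  obtain rfl := Finset.HasAntidiagonal.mem_antidiagonal.1 hij
  rw [integral_flipLaw_prod hl hK hC, Nat.choose_symm_add, Nat.add_choose, Nat.cast_div
    (Nat.factorial_mul_factorial_dvd_factorial_add _ _) (by positivity)]
  push_cast
  have hi := Nat.factorial_ne_zero ij.1
  have hj := Nat.factorial_ne_zero ij.2
  have hn := Nat.factorial_ne_zero (ij.1 + ij.2)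
  field_simp

theorem integral_splitSum_zero (K : SpinPath β → SpinPath β → ℝ) :
    ∫ x, splitSum K x ∂pointLaw β 0 =
      K (plus β) (plus β) + K (plus β) (minus β) + (K (minus β) (plus β) +
        K (minus β) (minus β)) := by
  have h : ∀ x : Fin 0 → Icc (0 : ℝ) β, splitSum K x =
      K (plus β) (plus β) + K (plus β) (minus β) + (K (minus β) (plus β) +
        K (minus β) (minus β)) := by
    intro x
    have huniv : (Finset.univ : Finset ℤˣ) = {1, -1} := by decide
    have hs : (Finset.univ : Finset (Finset (Fin 0))) = {∅} := by decide
    have h1 : ∀ S : Finset (Fin 0), flipOn 1 x S = plus β := fun S =>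
      SpinPath.ext (funext fun t => (flipOn_apply 1 x S t).trans (by
        simp [Finset.eq_empty_of_isEmpty S, plus]))
    have h2 : ∀ S : Finset (Fin 0), flipOn (-1) x S = minus β := fun S =>
      SpinPath.ext (funext fun t => (flipOn_apply (-1) x S t).trans (by
        simp [Finset.eq_empty_of_isEmpty S, minus]))
    have hne : (1 : ℤˣ) ≠ -1 := by decide
    simp only [splitSum, huniv, Finset.sum_pair hne, hs, Finset.sum_singleton, h1, h2]
  simp only [h]
  simp [Measure.real]

end SpinPath

end

/-! ### Tilted measures and the quantitative bound -/

noncomputable section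

namespace SpinPath

variable {β : ℝ}

theorem measurable_coe (hβ : 0 < β) (σ : SpinPath β) : Measurable σ.toFun :=
  (measurable_uncurry hβ).comp (measurable_prodMk_left (x := σ))

theorem integrable_mul_path (hβ : 0 < β) {h : Icc (0 : ℝ) β → ℝ}
    (hh : Integrable h (lebesgue β)) (σ : SpinPath β) :
    Integrable (fun t => h t * σ t) (lebesgue β) :=
  hh.mul_bdd (c := 1) (measurable_coe hβ σ).aestronglyMeasurable
    (Eventually.of_forall fun t => (abs_eq_one σ t).le)

theorem dot_add_dot (hβ : 0 < β) {h : Icc (0 : ℝ) β → ℝ} (hh : Integrable h (lebesgue β))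
    (σ σ' : SpinPath β) : dot h σ + dot h σ' = ∫ t, h t * (σ t + σ' t) ∂lebesgue β := by
  simp only [dot, mul_add]
  exact (integral_add (integrable_mul_path hβ hh σ) (integrable_mul_path hβ hh σ')).symm

theorem dot_add_sub (hβ : 0 < β) {h h' : Icc (0 : ℝ) β → ℝ} (hh : Integrable h (lebesgue β))
    (hh' : Integrable h' (lebesgue β)) (σ : SpinPath β) :
    dot h' σ = dot h σ + dot (fun t => h' t - h t) σ := by
  simp only [dot]
  rw [← integral_add (integrable_mul_path hβ hh σ)
    (integrable_mul_path hβ (h := fun t => h' t - h t) (hh'.sub hh) σ)]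
  exact integral_congr_ae (Eventually.of_forall fun t => by dsimp only; ring)

theorem pairWeight_exp_dot (hβ : 0 < β) {h : Icc (0 : ℝ) β → ℝ}
    (hh : Integrable h (lebesgue β)) : PairWeight fun σ => Real.exp (dot h σ) := by
  intro σ σ' ρ ρ' heq
  simp only [← Real.exp_add, dot_add_dot hβ hh, heq]

theorem pointwiseMono_exp_dot (hβ : 0 < β) {g : Icc (0 : ℝ) β → ℝ}
    (hg : Integrable g (lebesgue β)) (hg₀ : ∀ᵐ t ∂lebesgue β, 0 ≤ g t) :
    PointwiseMono fun σ => Real.exp (dot g σ) := by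
  intro σ σ' hσ
  refine Real.exp_le_exp.2 (integral_mono_ae (integrable_mul_path hβ hg σ)
    (integrable_mul_path hβ hg σ') ?_)
  filter_upwards [hg₀] with t ht using mul_le_mul_of_nonneg_left (hσ t) ht

theorem Increasing.pointwiseMono {f : SpinPath β → ℝ} (hf : Increasing f) : PointwiseMono f :=
  fun _ _ h => hf _ _ (Eventually.of_forall h)

theorem Increasing.abs_le {f : SpinPath β → ℝ} (hf : Increasing f) (σ : SpinPath β) :
    |f σ| ≤ |f (minus β)| + |f (plus β)| := by
  have h1 : f (minus β) ≤ f σ := hf.pointwiseMono _ _ fun t => by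
    rcases σ.spin t with h | h <;> rw [h] <;> norm_num [minus]
  have h2 : f σ ≤ f (plus β) := hf.pointwiseMono _ _ fun t => by
    rcases σ.spin t with h | h <;> rw [h] <;> norm_num [plus]
  have h3 := neg_abs_le (f (minus β))
  have h4 := le_abs_self (f (plus β))
  have h5 := abs_nonneg (f (minus β))
  have h6 := abs_nonneg (f (plus β))
  exact _root_.abs_le.2 ⟨by linarith, by linarith⟩

/-- The density of `spinMeasure` with respect to `freeLaw`, without normalization. -/
def spinWeight (hβ : 0 < β) (b : TimeBC) (h : Icc (0 : ℝ) β → ℝ) : SpinPath β → ℝ :=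
  (b.allowed hβ).indicator fun σ => Real.exp (dot h σ)

theorem measurable_exp_dot (hβ : 0 < β) {h : Icc (0 : ℝ) β → ℝ}
    (hh : Integrable h (lebesgue β)) :
    Measurable fun σ : SpinPath β => Real.exp (dot h σ) :=
  Real.measurable_exp.comp (stronglyMeasurable_dot hβ hh).measurable

theorem measurable_spinWeight (hβ : 0 < β) (b : TimeBC) {h : Icc (0 : ℝ) β → ℝ}
    (hh : Integrable h (lebesgue β)) : Measurable (spinWeight hβ b h) :=
  (measurable_exp_dot hβ hh).indicator (measurableSet_allowed hβ b)

theorem spinWeight_nonneg (hβ : 0 < β) (b : TimeBC) (h : Icc (0 : ℝ) β → ℝ) (σ : SpinPath β) :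
    0 ≤ spinWeight hβ b h σ :=
  indicator_nonneg (fun _ _ => (Real.exp_pos _).le) σ

theorem exp_dot_le (h : Icc (0 : ℝ) β → ℝ) (σ : SpinPath β) :
    Real.exp (dot h σ) ≤ Real.exp (∫ t, |h t| ∂lebesgue β) :=
  Real.exp_le_exp.2 ((le_abs_self _).trans (abs_dot_le h σ))

theorem abs_spinWeight_le (hβ : 0 < β) (b : TimeBC) (h : Icc (0 : ℝ) β → ℝ) (σ : SpinPath β) :
    |spinWeight hβ b h σ| ≤ Real.exp (∫ t, |h t| ∂lebesgue β) := by
  rw [abs_of_nonneg (spinWeight_nonneg hβ b h σ)]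
  exact (indicator_le_self' (fun _ _ => (Real.exp_pos _).le) σ).trans (exp_dot_le h σ)

theorem integral_spinMeasure (hβ : 0 < β) (lam : ℝ) (b : TimeBC) (h : Icc (0 : ℝ) β → ℝ)
    (f : SpinPath β → ℝ) :
    ∫ σ, f σ ∂spinMeasure hβ lam b h =
      (∫ σ, spinWeight hβ b h σ * f σ ∂freeLaw β lam) /
        ∫ σ, spinWeight hβ b h σ ∂freeLaw β lam := by
  have h1 : ∀ σ, spinWeight hβ b h σ * f σ =
      (b.allowed hβ).indicator (fun σ => Real.exp (dot h σ) * f σ) σ := fun σ =>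
    (indicator_mul_left _ _ _).symm
  simp only [spinMeasure, integral_tilted, smul_eq_mul, div_mul_eq_mul_div, integral_div, h1]
  rw [integral_indicator (measurableSet_allowed hβ b), spinWeight,
    integral_indicator (measurableSet_allowed hβ b)]

/-- Were the normalization zero, the convention `x / 0 = 0` would give the constant `1` expectation
`0` under a probability measure. -/
theorem integral_spinWeight_pos (hβ : 0 < β) {lam : ℝ} (hl : 0 ≤ lam) (b : TimeBC)
    {h : Icc (0 : ℝ) β → ℝ} (hh : Integrable h (lebesgue β)) :
    0 < ∫ σ, spinWeight hβ b h σ ∂freeLaw β lam := by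
  have := isProbabilityMeasure_spinMeasure hβ hl b hh
  have h1 := integral_spinMeasure hβ lam b h fun _ => 1
  refine (integral_nonneg (spinWeight_nonneg hβ b h)).lt_of_ne fun h0 => ?_
  rw [← h0, div_zero] at h1
  simp at h1

theorem integral_spinWeight_le (hβ : 0 < β) {lam : ℝ} (hl : 0 ≤ lam) (b : TimeBC)
    (h : Icc (0 : ℝ) β → ℝ) :
    ∫ σ, spinWeight hβ b h σ ∂freeLaw β lam ≤ Real.exp (∫ t, |h t| ∂lebesgue β) := by
  have : IsProbabilityMeasure (freeLaw β lam) := ⟨freeLaw_univ hβ hl⟩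
  have := norm_integral_le_of_norm_le_const (μ := freeLaw β lam) (f := spinWeight hβ b h)
    (Eventually.of_forall fun σ => (Real.norm_eq_abs _).trans_le (abs_spinWeight_le hβ b h σ))
  rw [probReal_univ, mul_one] at this
  exact (le_abs_self _).trans this

/-- The symmetrized form of the difference of two expectations. -/
theorem integral_pairKernel {μ : Measure (SpinPath β)} [IsProbabilityMeasure μ]
    {A : Set (SpinPath β)} {w f q : SpinPath β → ℝ} (hA : Measurable (A.indicator w))
    (hf : Measurable f) (hq : Measurable q) {Cw Cf Cq : ℝ} (hCw : ∀ σ, |A.indicator w σ| ≤ Cw)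
    (hCf : ∀ σ, |f σ| ≤ Cf) (hCq : ∀ σ, |q σ| ≤ Cq) :
    ∫ z, pairKernel A w f q z.1 z.2 ∂μ.prod μ =
      2 * ((∫ σ, A.indicator w σ * q σ * f σ ∂μ) * (∫ σ, A.indicator w σ ∂μ) -
        (∫ σ, A.indicator w σ * f σ ∂μ) * ∫ σ, A.indicator w σ * q σ ∂μ) := by
  set ω := A.indicator w
  have iw : Integrable ω μ := integrable_of_abs_le hA hCw
  have iwf : Integrable (fun σ => ω σ * f σ) μ := iw.mul_bdd hf.aestronglyMeasurable
    (Eventually.of_forall hCf)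
  have iwq : Integrable (fun σ => ω σ * q σ) μ := iw.mul_bdd hq.aestronglyMeasurable
    (Eventually.of_forall hCq)
  have iwqf : Integrable (fun σ => ω σ * q σ * f σ) μ := iwq.mul_bdd hf.aestronglyMeasurable
    (Eventually.of_forall hCf)
  have hexp : ∀ z : SpinPath β × SpinPath β, pairKernel A w f q z.1 z.2 =
      (ω z.1 * q z.1 * f z.1) * ω z.2 - (ω z.1 * f z.1) * (ω z.2 * q z.2) -
        (ω z.1 * q z.1) * (ω z.2 * f z.2) + ω z.1 * (ω z.2 * q z.2 * f z.2) := fun z => by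
    simp only [pairKernel, ω]; ring
  have i1 := iwqf.mul_prod iw
  have i2 := iwf.mul_prod iwq
  have i3 := iwq.mul_prod iwf
  have i4 := iw.mul_prod iwqf
  simp only [hexp]
  refine ((integral_add ((i1.sub i2).sub i3) i4).trans (congrArg (· + _)
    ((integral_sub (i1.sub i2) i3).trans (congrArg (· - _) (integral_sub i1 i2))))).trans ?_
  rw [integral_prod_mul (fun σ => ω σ * q σ * f σ) ω,
    integral_prod_mul (fun σ => ω σ * f σ) fun σ => ω σ * q σ,
    integral_prod_mul (fun σ => ω σ * q σ) fun σ => ω σ * f σ,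
    integral_prod_mul ω fun σ => ω σ * q σ * f σ]
  ring

/-- Every term of the series over merged flips is nonnegative, so the term `n = 0` is a lower bound.
There the equal pairs contribute nothing, and the two mixed pairs turn `1/4` into `1/2`. -/
theorem le_integral_pairKernel (hβ : 0 < β) {lam : ℝ} (hl : 0 ≤ lam) (b : TimeBC)
    {w f q : SpinPath β → ℝ} (hw₀ : ∀ σ, 0 ≤ w σ) (hw : PairWeight w) (hf : PointwiseMono f)
    (hq : PointwiseMono q) (hA : Measurable ((b.allowed hβ).indicator w))
    (hfm : Measurable f) (hqm : Measurable q) {Cw Cf Cq : ℝ}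
    (hCw : ∀ σ, |(b.allowed hβ).indicator w σ| ≤ Cw)
    (hCf : ∀ σ, |f σ| ≤ Cf) (hCq : ∀ σ, |q σ| ≤ Cq) :
    Real.exp (-(lam * β)) ^ 2 * 2⁻¹ * (w (plus β) * w (minus β) *
      ((f (plus β) - f (minus β)) * (q (plus β) - q (minus β)))) ≤
      ∫ z, pairKernel (b.allowed hβ) w f q z.1 z.2 ∂(freeLaw β lam).prod (freeLaw β lam) := by
  set K := pairKernel (b.allowed hβ) w f q with hKdef
  have hK : Measurable (Function.uncurry K) :=
    ((hA.comp measurable_fst).mul (hA.comp measurable_snd)).mul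
      (((hfm.comp measurable_fst).sub (hfm.comp measurable_snd)).mul
        ((hqm.comp measurable_fst).sub (hqm.comp measurable_snd)))
  have hC : ∀ σ σ', |K σ σ'| ≤ Cw * Cw * ((Cf + Cf) * (Cq + Cq)) := by
    intro σ σ'
    simp only [hKdef, pairKernel, abs_mul]
    have h0 : 0 ≤ Cw := (abs_nonneg _).trans (hCw σ)
    have h1 : 0 ≤ Cf := (abs_nonneg _).trans (hCf σ)
    gcongr
    · exact hCw σ
    · exact hCw σ'
    · exact (abs_sub _ _).trans (add_le_add (hCf σ) (hCf σ'))
    · exact (abs_sub _ _).trans (add_le_add (hCq σ) (hCq σ'))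
  have hs := hasSum_integral_freeLaw_prod hβ hl hK hC
  refine le_trans (le_of_eq ?_) (le_hasSum hs 0 fun n _ => ?_)
  · have hp : plus β ∈ b.allowed hβ := by cases b <;> simp [TimeBC.allowed, plus]
    have hm : minus β ∈ b.allowed hβ := by cases b <;> simp [TimeBC.allowed, minus]
    rw [integral_splitSum_zero]
    simp only [hKdef, pairKernel, indicator_of_mem hp, indicator_of_mem hm, pow_zero,
      Nat.factorial_zero, Nat.cast_one]
    ring
  · exact mul_nonneg (by positivity) (integral_nonneg fun x =>
      sum_pairKernel_flipOn_nonneg hβ b hw₀ hw hf hq x)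

theorem dot_plus (h : Icc (0 : ℝ) β → ℝ) : dot h (plus β) = ∫ t, h t ∂lebesgue β := by
  simp [dot, plus]

theorem dot_minus (h : Icc (0 : ℝ) β → ℝ) : dot h (minus β) = -∫ t, h t ∂lebesgue β := by
  simp [dot, minus, integral_neg]

theorem two_mul_le_exp_sub_exp_neg {x : ℝ} (hx : 0 ≤ x) :
    2 * x ≤ Real.exp x - Real.exp (-x) := by
  have := Real.self_le_sinh_iff.2 hx
  rw [Real.sinh_eq] at this
  linarith

/-- The expectation of an increasing function grows at least linearly in the field. -/
theorem le_integral_spinMeasure_sub (hβ : 0 < β) {lam M : ℝ} (hl : 0 ≤ lam) (hlM : lam ≤ M)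
    (b : TimeBC) {h h' : Icc (0 : ℝ) β → ℝ} (hh : Integrable h (lebesgue β))
    (hh' : Integrable h' (lebesgue β)) (hM : ∫ t, |h t| ∂lebesgue β ≤ M)
    (hM' : ∫ t, |h' t| ∂lebesgue β ≤ M) (hle : ∀ᵐ t ∂lebesgue β, h t ≤ h' t)
    {f : SpinPath β → ℝ} (hfm : Measurable f) (hf : Increasing f) :
    2⁻¹ * Real.exp (-(M * β)) ^ 2 * Real.exp (-M) ^ 2 * (f (plus β) - f (minus β)) *
        (∫ t, (h' t - h t) ∂lebesgue β) ≤
      (∫ σ, f σ ∂spinMeasure hβ lam b h') - ∫ σ, f σ ∂spinMeasure hβ lam b h := by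
  have : IsProbabilityMeasure (freeLaw β lam) := ⟨freeLaw_univ hβ hl⟩
  set g : Icc (0 : ℝ) β → ℝ := fun t => h' t - h t with hg
  have hgi : Integrable g (lebesgue β) := hh'.sub hh
  have hg₀ : ∀ᵐ t ∂lebesgue β, 0 ≤ g t := hle.mono fun t ht => sub_nonneg.2 ht
  set G := ∫ t, g t ∂lebesgue β
  have hG : 0 ≤ G := integral_nonneg_of_ae hg₀
  set D := f (plus β) - f (minus β)
  have hD : 0 ≤ D := sub_nonneg.2 (hf _ _ (Eventually.of_forall fun t => by
    norm_num [plus, minus]))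
  have hlow := le_integral_pairKernel hβ hl b (fun σ => (Real.exp_pos (dot h σ)).le)
    (pairWeight_exp_dot hβ hh) hf.pointwiseMono (pointwiseMono_exp_dot hβ hgi hg₀)
    (measurable_spinWeight hβ b hh) hfm (measurable_exp_dot hβ hgi) (abs_spinWeight_le hβ b h)
    hf.abs_le fun σ => (Real.abs_exp _).trans_le (exp_dot_le g σ)
  rw [integral_pairKernel (measurable_spinWeight hβ b hh) hfm (measurable_exp_dot hβ hgi)
    (abs_spinWeight_le hβ b h) hf.abs_le fun σ => (Real.abs_exp _).trans_le (exp_dot_le g σ),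
    dot_plus, dot_minus, dot_plus, dot_minus, ← Real.exp_add, add_neg_cancel, Real.exp_zero,
    one_mul] at hlow
  -- Tilting by `g` on top of `h` is tilting by `h'`, so the covariance compares the two fields.
  have hω : ∀ σ, (b.allowed hβ).indicator (fun σ => Real.exp (dot h σ)) σ * Real.exp (dot g σ) =
      spinWeight hβ b h' σ := by
    intro σ
    rw [← indicator_mul_left (b.allowed hβ) (fun σ => Real.exp (dot h σ))
      fun σ => Real.exp (dot g σ)]
    simp only [spinWeight, dot_add_sub hβ hh hh', Real.exp_add, hg]
  simp only [hω] at hlow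
  change _ ≤ 2 * ((∫ σ, spinWeight hβ b h' σ * f σ ∂freeLaw β lam) *
    (∫ σ, spinWeight hβ b h σ ∂freeLaw β lam) - (∫ σ, spinWeight hβ b h σ * f σ ∂freeLaw β lam) *
    ∫ σ, spinWeight hβ b h' σ ∂freeLaw β lam) at hlow
  rw [integral_spinMeasure, integral_spinMeasure]
  have hZ := integral_spinWeight_pos hβ hl b hh
  have hZ' := integral_spinWeight_pos hβ hl b hh'
  have hZM := (integral_spinWeight_le hβ hl b h).trans (Real.exp_le_exp.2 hM)
  have hZM' := (integral_spinWeight_le hβ hl b h').trans (Real.exp_le_exp.2 hM')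
  set Z := ∫ σ, spinWeight hβ b h σ ∂freeLaw β lam
  set Z' := ∫ σ, spinWeight hβ b h' σ ∂freeLaw β lam
  rw [div_sub_div _ _ hZ'.ne' hZ.ne', le_div_iff₀ (mul_pos hZ' hZ)]
  have hexp := two_mul_le_exp_sub_exp_neg hG
  have hlexp : Real.exp (-(M * β)) ≤ Real.exp (-(lam * β)) := by gcongr
  -- Both normalizations are at most `exp M`; the factor `exp (-M) ^ 2` in the constant pays for
  -- them.
  have hZZ : Real.exp (-M) ^ 2 * (Z' * Z) ≤ 1 := by
    have h1 : Real.exp (-M) * Real.exp M = 1 := by rw [← Real.exp_add]; simp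
    calc Real.exp (-M) ^ 2 * (Z' * Z) ≤ Real.exp (-M) ^ 2 * (Real.exp M * Real.exp M) := by gcongr
      _ = (Real.exp (-M) * Real.exp M) ^ 2 := by ring
      _ = 1 := by rw [h1, one_pow]
  have hstep : Real.exp (-(M * β)) ^ 2 * 2⁻¹ * (D * (2 * G)) ≤
      Real.exp (-(lam * β)) ^ 2 * 2⁻¹ * (D * (Real.exp G - Real.exp (-G))) := by gcongr
  have hfin : 2⁻¹ * Real.exp (-(M * β)) ^ 2 * Real.exp (-M) ^ 2 * D * G * (Z' * Z) ≤
      2⁻¹ * Real.exp (-(M * β)) ^ 2 * D * G := by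
    have : 0 ≤ 2⁻¹ * Real.exp (-(M * β)) ^ 2 * D * G := by positivity
    calc _ = 2⁻¹ * Real.exp (-(M * β)) ^ 2 * D * G * (Real.exp (-M) ^ 2 * (Z' * Z)) := by ring
      _ ≤ _ := mul_le_of_le_one_right this hZZ
  linarith

end SpinPath

end

theorem theorem3p2 (β M : ℝ) (hβ : 0 < β) :
    ∃ c : ℝ, 0 < c ∧
      ∀ (lam : ℝ) (h h' : Icc (0 : ℝ) β → ℝ),
        0 ≤ lam → lam < M →
        Integrable h (lebesgue β) → Integrable h' (lebesgue β) →
        (∫ t, |h t| ∂lebesgue β) < M → (∫ t, |h' t| ∂lebesgue β) < M →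
        (∀ᵐ t ∂lebesgue β, h t ≤ h' t) →
        ∀ b : SpinPath.TimeBC,
          SpinPath.StochLE (SpinPath.spinMeasure hβ lam b h)
            (SpinPath.spinMeasure hβ lam b h') ∧
          ∀ f : SpinPath β → ℝ, Measurable f → SpinPath.Increasing f →
            c * (f (SpinPath.plus β) - f (SpinPath.minus β)) * (∫ t, (h' t - h t) ∂lebesgue β) ≤
              (∫ σ, f σ ∂(SpinPath.spinMeasure hβ lam b h')) -
                (∫ σ, f σ ∂(SpinPath.spinMeasure hβ lam b h)) := by
  -- The exponentials bound below the probability of no flips in either spin and `1 / (Z Z')`. The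
  -- `2⁻¹` is `1/2` from the mixed constant pairs, times `1/2` from symmetrization, times `2` from
  -- `exp x - exp (-x) ≥ 2 x`.
  refine ⟨2⁻¹ * Real.exp (-(M * β)) ^ 2 * Real.exp (-M) ^ 2, by positivity,
    fun lam h h' hl hlM hh hh' hM hM' hle b => ?_⟩
  have key := fun f hfm hf => SpinPath.le_integral_spinMeasure_sub hβ hl hlM.le b hh hh' hM.le
    hM'.le hle (f := f) hfm hf
  refine ⟨fun f hfm hf => ?_, key⟩
  refine sub_nonneg.1 (le_trans (mul_nonneg (mul_nonneg (by positivity) ?_) ?_) (key f hfm hf))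
  · exact sub_nonneg.2 (hf _ _ (Eventually.of_forall fun t => by
      norm_num [SpinPath.plus, SpinPath.minus]))
  · exact integral_nonneg_of_ae (hle.mono fun t ht => sub_nonneg.2 ht)
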